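/- **Theorem (Equational consistency).** Consider the dependent type theory with the judgements $\Gamma\ \mathrm{ctx}$, $\Gamma\vdash A\ \mathrm{type}$, $\Gamma\vdash A=B\ \mathrm{type}$, $\Gamma\vdash t:A$ and $\Gamma\vdash t=t':A$, where contexts are finite lists $x_1:A_1,\dots,x_n:A_n$ of types (each well formed over its predecessors), equality of types and of terms is an equivalence relation that is respected by typing (conversion: if $\Gamma\vdash A=B\ \mathrm{type}$, then terms, and equal terms, of type $A$ are terms, and equal terms, of type $B$) and by all type and term formers, variables have their declared types, and the formers and further equations are the following. * A base type $\mathsf{Ans}$ with two constants $\mathsf{yes},\mathsf{no}:\mathsf{Ans}$ and no elimination rule. * Dependent functions: for $\Gamma\vdash A\ \mathrm{type}$ and $\Gamma,x:A\vdash B\ \mathrm{type}$ a type $\prod_{x:A}B$; if $\Gamma,x:A\vdash t:B$ then $\lambda(x:A).\,t:\prod_{x:A}B$; if $f:\prod_{x:A}B$ and $a:A$ then $f(a):B[x/a]$; with $(\lambda(x:A).\,t)(a)=t[x/a]:B[x/a]$ ($\beta$) and $f=\lambda(x:A).\,f(x):\prod_{x:A}B$ ($\eta$). * Dependent pairs: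 for the same $A,B$ a type $\sum_{x:A}B$; if $a:A$ and $b:B[x/a]$ then $(a,b):\sum_{x:A}B$; if $p:\sum_{x:A}B$ then $\pi_1(p):A$ and $\pi_2(p):B[x/\pi_1(p)]$; with $\pi_1(a,b)=a:A$, $\pi_2(a,b)=b:B[x/a]$ ($\beta$) and $p=(\pi_1(p),\pi_2(p)):\sum_{x:A}B$ ($\eta$). * A Tarski universe: a type $\mathsf U$, a type $\mathsf{El}(c)$ for every $c:\mathsf U$, and codes $\mathsf{ans}:\mathsf U$ and, for $\Gamma\vdash a:\mathsf U$ and $\Gamma,x:\mathsf{El}(a)\vdash b:\mathsf U$, $\mathsf{pi}(a,x.b):\mathsf U$ and $\mathsf{sigma}(a,x.b):\mathsf U$, with the judgemental equalities of types $\mathsf{El}(\mathsf{ans})=\mathsf{Ans}$, $\mathsf{El}(\mathsf{pi}(a,x.b))=\prod_{x:\mathsf{El}(a)}\mathsf{El}(b)$ and $\mathsf{El}(\mathsf{sigma}(a,x.b))=\sum_{x:\mathsf{El}(a)}\mathsf{El}(b)$. Then the judgement $\vdash\mathsf{yes}=\mathsf{no}:\mathsf{Ans}$ in the empty context is not derivable.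 -/

import Mathlib

/-! Dependent type theory with `Π`, `Σ`, a type `Ans` with two constants and no eliminator, and a
Tarski universe `U`: raw syntax with de Bruijn indices, substitution, and the derivation rules. -/

namespace DepTT

/-! ### Raw syntax -/

mutual

/-- Raw types. In `pi A B` and `sigma A B` the type `B` is under one binder. -/
inductive Ty : Type
  | ans : Ty
  | pi (A B : Ty) : Ty
  | sigma (A B : Ty) : Ty
  /-- the universe of codes -/
  | univ : Ty
  /-- the type decoded from a code -/
  | el (c : Tm) : Ty

/-- Raw terms. `lam A t` is `λ (x : A), t`; the second arguments of `lam`, `piCode` and `sigmaCode`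
are under one binder. -/
inductive Tm : Type
  | var (n : ℕ) : Tm
  | yes : Tm
  | no : Tm
  | lam (A : Ty) (t : Tm) : Tm
  | app (f a : Tm) : Tm
  | pair (a b : Tm) : Tm
  | fst (p : Tm) : Tm
  | snd (p : Tm) : Tm
  | ansCode : Tm
  | piCode (a b : Tm) : Tm
  | sigmaCode (a b : Tm) : Tm

end

/-! ### Renaming and substitution -/

/-- A renaming, extended under one binder. -/
def liftRen (r : ℕ → ℕ) : ℕ → ℕ
  | 0 => 0
  | n + 1 => r n + 1

mutual

def Ty.rename (r : ℕ → ℕ) : Ty → Ty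
  | .ans => .ans
  | .pi A B => .pi (A.rename r) (B.rename (liftRen r))
  | .sigma A B => .sigma (A.rename r) (B.rename (liftRen r))
  | .univ => .univ
  | .el c => .el (c.rename r)

def Tm.rename (r : ℕ → ℕ) : Tm → Tm
  | .var n => .var (r n)
  | .yes => .yes
  | .no => .no
  | .lam A t => .lam (A.rename r) (t.rename (liftRen r))
  | .app f a => .app (f.rename r) (a.rename r)
  | .pair a b => .pair (a.rename r) (b.rename r)
  | .fst p => .fst (p.rename r)
  | .snd p => .snd (p.rename r)
  | .ansCode => .ansCode
  | .piCode a b => .piCode (a.rename r) (b.rename (liftRen r))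
  | .sigmaCode a b => .sigmaCode (a.rename r) (b.rename (liftRen r))

end

/-- Weakening of a type by one fresh variable. -/
def Ty.weaken (A : Ty) : Ty := A.rename Nat.succ

/-- Weakening of a term by one fresh variable. -/
def Tm.weaken (t : Tm) : Tm := t.rename Nat.succ

/-- A substitution, extended under one binder. -/
def liftSub (s : ℕ → Tm) : ℕ → Tm
  | 0 => .var 0
  | n + 1 => (s n).weaken

mutual

def Ty.subst (s : ℕ → Tm) : Ty → Ty
  | .ans => .ans
  | .pi A B => .pi (A.subst s) (B.subst (liftSub s))
  | .sigma A B => .sigma (A.subst s) (B.subst (liftSub s))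
  | .univ => .univ
  | .el c => .el (c.subst s)

def Tm.subst (s : ℕ → Tm) : Tm → Tm
  | .var n => s n
  | .yes => .yes
  | .no => .no
  | .lam A t => .lam (A.subst s) (t.subst (liftSub s))
  | .app f a => .app (f.subst s) (a.subst s)
  | .pair a b => .pair (a.subst s) (b.subst s)
  | .fst p => .fst (p.subst s)
  | .snd p => .snd (p.subst s)
  | .ansCode => .ansCode
  | .piCode a b => .piCode (a.subst s) (b.subst (liftSub s))
  | .sigmaCode a b => .sigmaCode (a.subst s) (b.subst (liftSub s))

end

/-- The substitution that replaces variable `0` by `a` and lowers the other variables by one. -/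
def single (a : Tm) : ℕ → Tm
  | 0 => a
  | n + 1 => .var n

/-- `B[x/a]` for a type `B` under one binder. -/
def Ty.inst (B : Ty) (a : Tm) : Ty := B.subst (single a)

/-- `t[x/a]` for a term `t` under one binder. -/
def Tm.inst (t a : Tm) : Tm := t.subst (single a)

/-! ### Judgements -/

/-- Contexts: lists of types, the most recently added type first. -/
abbrev Ctx : Type := List Ty

/-- `Lookup Γ n A`: variable `n` is declared in `Γ` with type `A` (weakened to all of `Γ`). -/
inductive Lookup : Ctx → ℕ → Ty → Prop
  | here {Γ : Ctx} {A : Ty} : Lookup (A :: Γ) 0 A.weaken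
  | there {Γ : Ctx} {n : ℕ} {A B : Ty} : Lookup Γ n A → Lookup (B :: Γ) (n + 1) A.weaken

mutual

/-- `Γ ctx`. -/
inductive IsCtx : Ctx → Prop
  | nil : IsCtx []
  | cons {Γ : Ctx} {A : Ty} : IsCtx Γ → IsTy Γ A → IsCtx (A :: Γ)

/-- `Γ ⊢ A type`. -/
inductive IsTy : Ctx → Ty → Prop
  | ans {Γ : Ctx} : IsCtx Γ → IsTy Γ .ans
  | pi {Γ : Ctx} {A B : Ty} : IsTy Γ A → IsTy (A :: Γ) B → IsTy Γ (.pi A B)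
  | sigma {Γ : Ctx} {A B : Ty} : IsTy Γ A → IsTy (A :: Γ) B → IsTy Γ (.sigma A B)
  | univ {Γ : Ctx} : IsCtx Γ → IsTy Γ .univ
  | el {Γ : Ctx} {c : Tm} : HasTy Γ c .univ → IsTy Γ (.el c)

/-- `Γ ⊢ A = B type`. -/
inductive TyEq : Ctx → Ty → Ty → Prop
  | refl {Γ : Ctx} {A : Ty} : IsTy Γ A → TyEq Γ A A
  | symm {Γ : Ctx} {A B : Ty} : TyEq Γ A B → TyEq Γ B A
  | trans {Γ : Ctx} {A B C : Ty} : TyEq Γ A B → TyEq Γ B C → TyEq Γ A C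
  | pi_congr {Γ : Ctx} {A A' B B' : Ty} :
      IsTy Γ A → TyEq Γ A A' → TyEq (A :: Γ) B B' → TyEq Γ (.pi A B) (.pi A' B')
  | sigma_congr {Γ : Ctx} {A A' B B' : Ty} :
      IsTy Γ A → TyEq Γ A A' → TyEq (A :: Γ) B B' → TyEq Γ (.sigma A B) (.sigma A' B')
  | el_congr {Γ : Ctx} {c c' : Tm} : TmEq Γ c c' .univ → TyEq Γ (.el c) (.el c')
  | el_ans {Γ : Ctx} : IsCtx Γ → TyEq Γ (.el .ansCode) .ans
  | el_pi {Γ : Ctx} {a b : Tm} :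
      HasTy Γ a .univ → HasTy (.el a :: Γ) b .univ →
      TyEq Γ (.el (.piCode a b)) (.pi (.el a) (.el b))
  | el_sigma {Γ : Ctx} {a b : Tm} :
      HasTy Γ a .univ → HasTy (.el a :: Γ) b .univ →
      TyEq Γ (.el (.sigmaCode a b)) (.sigma (.el a) (.el b))

/-- `Γ ⊢ t : A`. -/
inductive HasTy : Ctx → Tm → Ty → Prop
  | var {Γ : Ctx} {n : ℕ} {A : Ty} : IsCtx Γ → Lookup Γ n A → HasTy Γ (.var n) A
  | conv {Γ : Ctx} {t : Tm} {A B : Ty} : HasTy Γ t A → TyEq Γ A B → HasTy Γ t B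
  | yes {Γ : Ctx} : IsCtx Γ → HasTy Γ .yes .ans
  | no {Γ : Ctx} : IsCtx Γ → HasTy Γ .no .ans
  | lam {Γ : Ctx} {A B : Ty} {t : Tm} :
      IsTy Γ A → HasTy (A :: Γ) t B → HasTy Γ (.lam A t) (.pi A B)
  | app {Γ : Ctx} {A B : Ty} {f a : Tm} :
      HasTy Γ f (.pi A B) → HasTy Γ a A → HasTy Γ (.app f a) (B.inst a)
  | pair {Γ : Ctx} {A B : Ty} {a b : Tm} :
      IsTy (A :: Γ) B → HasTy Γ a A → HasTy Γ b (B.inst a) → HasTy Γ (.pair a b) (.sigma A B)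
  | fst {Γ : Ctx} {A B : Ty} {p : Tm} : HasTy Γ p (.sigma A B) → HasTy Γ (.fst p) A
  | snd {Γ : Ctx} {A B : Ty} {p : Tm} :
      HasTy Γ p (.sigma A B) → HasTy Γ (.snd p) (B.inst (.fst p))
  | ansCode {Γ : Ctx} : IsCtx Γ → HasTy Γ .ansCode .univ
  | piCode {Γ : Ctx} {a b : Tm} :
      HasTy Γ a .univ → HasTy (.el a :: Γ) b .univ → HasTy Γ (.piCode a b) .univ
  | sigmaCode {Γ : Ctx} {a b : Tm} :
      HasTy Γ a .univ → HasTy (.el a :: Γ) b .univ → HasTy Γ (.sigmaCode a b) .univ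

/-- `Γ ⊢ t = t' : A`: the congruence generated by `β` and `η` for `Π` and `Σ`. -/
inductive TmEq : Ctx → Tm → Tm → Ty → Prop
  | refl {Γ : Ctx} {t : Tm} {A : Ty} : HasTy Γ t A → TmEq Γ t t A
  | symm {Γ : Ctx} {t t' : Tm} {A : Ty} : TmEq Γ t t' A → TmEq Γ t' t A
  | trans {Γ : Ctx} {t t' t'' : Tm} {A : Ty} : TmEq Γ t t' A → TmEq Γ t' t'' A → TmEq Γ t t'' A
  | conv {Γ : Ctx} {t t' : Tm} {A B : Ty} : TmEq Γ t t' A → TyEq Γ A B → TmEq Γ t t' B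
  | lam_congr {Γ : Ctx} {A A' B : Ty} {t t' : Tm} :
      IsTy Γ A → TyEq Γ A A' → TmEq (A :: Γ) t t' B → TmEq Γ (.lam A t) (.lam A' t') (.pi A B)
  | app_congr {Γ : Ctx} {A B : Ty} {f f' a a' : Tm} :
      TmEq Γ f f' (.pi A B) → TmEq Γ a a' A → TmEq Γ (.app f a) (.app f' a') (B.inst a)
  | pair_congr {Γ : Ctx} {A B : Ty} {a a' b b' : Tm} :
      IsTy (A :: Γ) B → TmEq Γ a a' A → TmEq Γ b b' (B.inst a) →
      TmEq Γ (.pair a b) (.pair a' b') (.sigma A B)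
  | fst_congr {Γ : Ctx} {A B : Ty} {p p' : Tm} :
      TmEq Γ p p' (.sigma A B) → TmEq Γ (.fst p) (.fst p') A
  | snd_congr {Γ : Ctx} {A B : Ty} {p p' : Tm} :
      TmEq Γ p p' (.sigma A B) → TmEq Γ (.snd p) (.snd p') (B.inst (.fst p))
  | piCode_congr {Γ : Ctx} {a a' b b' : Tm} :
      HasTy Γ a .univ → TmEq Γ a a' .univ → TmEq (.el a :: Γ) b b' .univ →
      TmEq Γ (.piCode a b) (.piCode a' b') .univ
  | sigmaCode_congr {Γ : Ctx} {a a' b b' : Tm} :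
      HasTy Γ a .univ → TmEq Γ a a' .univ → TmEq (.el a :: Γ) b b' .univ →
      TmEq Γ (.sigmaCode a b) (.sigmaCode a' b') .univ
  | pi_beta {Γ : Ctx} {A B : Ty} {t a : Tm} :
      HasTy (A :: Γ) t B → HasTy Γ a A → TmEq Γ (.app (.lam A t) a) (t.inst a) (B.inst a)
  | pi_eta {Γ : Ctx} {A B : Ty} {f : Tm} :
      HasTy Γ f (.pi A B) → TmEq Γ f (.lam A (.app f.weaken (.var 0))) (.pi A B)
  | fst_beta {Γ : Ctx} {A B : Ty} {a b : Tm} :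
      IsTy (A :: Γ) B → HasTy Γ a A → HasTy Γ b (B.inst a) → TmEq Γ (.fst (.pair a b)) a A
  | snd_beta {Γ : Ctx} {A B : Ty} {a b : Tm} :
      IsTy (A :: Γ) B → HasTy Γ a A → HasTy Γ b (B.inst a) →
      TmEq Γ (.snd (.pair a b)) b (B.inst a)
  | sigma_eta {Γ : Ctx} {A B : Ty} {p : Tm} :
      HasTy Γ p (.sigma A B) → TmEq Γ p (.pair (.fst p) (.snd p)) (.sigma A B)

end

end DepTT

/-! The set-theoretic model: raw types and terms are interpreted as `ZFSet`s, with the universe of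
codes interpreted by `V_ ω` and decoding by the identity. -/

namespace DepTT

open ZFSet Ordinal
open scoped ZFSet

attribute [local instance] Classical.allZFSetDefinable

/-! ### Dependent sums and products of ZFC sets -/

/-- The graph of `g` restricted to `a`. -/
noncomputable def graphOn (a : ZFSet.{0}) (g : ZFSet.{0} → ZFSet.{0}) : ZFSet.{0} :=
  ZFSet.image (fun x => ZFSet.pair x (g x)) a

/-- The set of pairs `(x, y)` with `x ∈ a` and `y ∈ b x`. -/
noncomputable def sigmaSet (a : ZFSet.{0}) (b : ZFSet.{0} → ZFSet.{0}) : ZFSet.{0} :=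
  ZFSet.sUnion (ZFSet.image (fun x => ZFSet.image (ZFSet.pair x) (b x)) a)

/-- The set of graphs of dependent functions on `a` with values in `b`. -/
noncomputable def piSet (a : ZFSet.{0}) (b : ZFSet.{0} → ZFSet.{0}) : ZFSet.{0} :=
  ZFSet.sep (fun f => ∃ g, f = graphOn a g) (ZFSet.powerset (sigmaSet a b))

/-- The value at `x` of a set regarded as the graph of a function. -/
noncomputable def graphApp (f x : ZFSet.{0}) : ZFSet.{0} :=
  Classical.epsilon fun y => ZFSet.pair x y ∈ f

/-- The first component of an ordered pair. -/
noncomputable def pairFst (p : ZFSet.{0}) : ZFSet.{0} :=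
  Classical.epsilon fun x => ∃ y, p = ZFSet.pair x y

/-- The second component of an ordered pair. -/
noncomputable def pairSnd (p : ZFSet.{0}) : ZFSet.{0} :=
  Classical.epsilon fun y => ∃ x, p = ZFSet.pair x y

theorem mem_graphOn {a : ZFSet.{0}} {g : ZFSet.{0} → ZFSet.{0}} {z : ZFSet.{0}} :
    z ∈ graphOn a g ↔ ∃ x ∈ a, ZFSet.pair x (g x) = z := by
  simp [graphOn]

theorem pair_mem_graphOn {a : ZFSet.{0}} {g : ZFSet.{0} → ZFSet.{0}} {x y : ZFSet.{0}} :
    ZFSet.pair x y ∈ graphOn a g ↔ x ∈ a ∧ g x = y := by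
  rw [mem_graphOn]
  constructor
  · rintro ⟨x', hx', h⟩
    obtain ⟨rfl, rfl⟩ := ZFSet.pair_inj.1 h
    exact ⟨hx', rfl⟩
  · rintro ⟨hx, rfl⟩
    exact ⟨x, hx, rfl⟩

theorem mem_sigmaSet {a : ZFSet.{0}} {b : ZFSet.{0} → ZFSet.{0}} {z : ZFSet.{0}} :
    z ∈ sigmaSet a b ↔ ∃ x ∈ a, ∃ y ∈ b x, ZFSet.pair x y = z := by
  simp [sigmaSet]

theorem pair_mem_sigmaSet {a : ZFSet.{0}} {b : ZFSet.{0} → ZFSet.{0}} {x y : ZFSet.{0}} :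
    ZFSet.pair x y ∈ sigmaSet a b ↔ x ∈ a ∧ y ∈ b x := by
  rw [mem_sigmaSet]
  constructor
  · rintro ⟨x', hx', y', hy', h⟩
    obtain ⟨rfl, rfl⟩ := ZFSet.pair_inj.1 h
    exact ⟨hx', hy'⟩
  · rintro ⟨hx, hy⟩
    exact ⟨x, hx, y, hy, rfl⟩

theorem mem_piSet {a : ZFSet.{0}} {b : ZFSet.{0} → ZFSet.{0}} {f : ZFSet.{0}} :
    f ∈ piSet a b ↔ ∃ g, f = graphOn a g ∧ ∀ x ∈ a, g x ∈ b x := by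
  rw [piSet, ZFSet.mem_sep, ZFSet.mem_powerset]
  constructor
  · rintro ⟨hf, g, rfl⟩
    exact ⟨g, rfl, fun x hx => (pair_mem_sigmaSet.1 (hf (pair_mem_graphOn.2 ⟨hx, rfl⟩))).2⟩
  · rintro ⟨g, rfl, hg⟩
    refine ⟨fun z hz => ?_, g, rfl⟩
    obtain ⟨x, hx, rfl⟩ := mem_graphOn.1 hz
    exact pair_mem_sigmaSet.2 ⟨hx, hg x hx⟩

theorem graphOn_congr {a : ZFSet.{0}} {g g' : ZFSet.{0} → ZFSet.{0}} (h : ∀ x ∈ a, g x = g' x) :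
    graphOn a g = graphOn a g' := by
  ext z
  simp only [mem_graphOn]
  exact exists_congr fun x => and_congr_right fun hx => by rw [h x hx]

theorem sigmaSet_congr {a : ZFSet.{0}} {b b' : ZFSet.{0} → ZFSet.{0}} (h : ∀ x ∈ a, b x = b' x) :
    sigmaSet a b = sigmaSet a b' := by
  ext z
  simp only [mem_sigmaSet]
  exact exists_congr fun x => and_congr_right fun hx => by rw [h x hx]

theorem piSet_congr {a : ZFSet.{0}} {b b' : ZFSet.{0} → ZFSet.{0}} (h : ∀ x ∈ a, b x = b' x) :
    piSet a b = piSet a b' := by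
  rw [piSet, piSet, sigmaSet_congr h]

theorem graphApp_graphOn {a x : ZFSet.{0}} (g : ZFSet.{0} → ZFSet.{0}) (hx : x ∈ a) :
    graphApp (graphOn a g) x = g x := by
  have h : ZFSet.pair x (graphApp (graphOn a g) x) ∈ graphOn a g :=
    Classical.epsilon_spec (p := fun y => ZFSet.pair x y ∈ graphOn a g)
      ⟨g x, pair_mem_graphOn.2 ⟨hx, rfl⟩⟩
  exact (pair_mem_graphOn.1 h).2.symm

theorem graphApp_mem {a f x : ZFSet.{0}} {b : ZFSet.{0} → ZFSet.{0}} (hf : f ∈ piSet a b)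
    (hx : x ∈ a) : graphApp f x ∈ b x := by
  obtain ⟨g, rfl, hg⟩ := mem_piSet.1 hf
  rw [graphApp_graphOn g hx]
  exact hg x hx

theorem graphOn_graphApp {a f : ZFSet.{0}} {b : ZFSet.{0} → ZFSet.{0}} (hf : f ∈ piSet a b) :
    graphOn a (graphApp f) = f := by
  obtain ⟨g, rfl, -⟩ := mem_piSet.1 hf
  exact graphOn_congr fun x hx => graphApp_graphOn g hx

theorem pairFst_pair (x y : ZFSet.{0}) : pairFst (ZFSet.pair x y) = x := by
  obtain ⟨y', h⟩ := Classical.epsilon_spec (p := fun x' => ∃ y', ZFSet.pair x y = ZFSet.pair x' y')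
    ⟨x, y, rfl⟩
  exact (ZFSet.pair_inj.1 h).1.symm

theorem pairSnd_pair (x y : ZFSet.{0}) : pairSnd (ZFSet.pair x y) = y := by
  obtain ⟨x', h⟩ := Classical.epsilon_spec (p := fun y' => ∃ x', ZFSet.pair x y = ZFSet.pair x' y')
    ⟨y, x, rfl⟩
  exact (ZFSet.pair_inj.1 h).2.symm

/-! ### Closure properties of `V_ ω` -/

theorem finite_vonNeumann_natCast (n : ℕ) : (V_ (n : Ordinal.{0}) : Set ZFSet.{0}).Finite := by
  induction n with
  | zero => simp
  | succ n ih =>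
    rw [Nat.cast_add_one, ZFSet.vonNeumann_add_one]
    have : Finite (𝒫 (V_ (n : Ordinal.{0}) : Set ZFSet.{0})) := ih.finite_subsets.to_subtype
    have : Finite (ZFSet.powerset (V_ (n : Ordinal.{0}))) :=
      Finite.of_equiv _ (ZFSet.powersetEquiv _).symm
    exact Set.toFinite _

theorem mem_vonNeumann_omega0 {x : ZFSet.{0}} :
    x ∈ V_ ω ↔ (x : Set ZFSet.{0}).Finite ∧ ∀ y ∈ x, y ∈ V_ ω := by
  constructor
  · intro h
    refine ⟨?_, fun y hy => ZFSet.isTransitive_vonNeumann _ x h hy⟩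
    obtain ⟨a, ha, hx⟩ := ZFSet.mem_vonNeumann'.1 h
    obtain ⟨n, rfl⟩ := Ordinal.lt_omega0.1 ha
    exact (finite_vonNeumann_natCast n).subset hx
  · rintro ⟨hfin, hx⟩
    have hn : ∀ y : ZFSet.{0}, ∃ n : ℕ, y ∈ x → y ∈ V_ (n : Ordinal.{0}) := by
      intro y
      by_cases hy : y ∈ x
      · obtain ⟨n, hn⟩ := Ordinal.lt_omega0.1 (ZFSet.mem_vonNeumann.1 (hx y hy))
        refine ⟨n + 1, fun _ => ZFSet.mem_vonNeumann.2 ?_⟩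
        rw [hn]
        exact_mod_cast Nat.lt_succ_self n
      · exact ⟨0, fun h => absurd h hy⟩
    choose N hN using hn
    obtain ⟨M, hM⟩ := (hfin.image N).bddAbove
    refine ZFSet.mem_vonNeumann'.2 ⟨M, Ordinal.natCast_lt_omega0 M, fun y hy => ?_⟩
    refine ZFSet.vonNeumann_subset_of_le ?_ (hN y hy)
    exact_mod_cast hM ⟨y, hy, rfl⟩

theorem pair_mem_vonNeumann_omega0 {x y : ZFSet.{0}} (hx : x ∈ V_ ω) (hy : y ∈ V_ ω) :
    ZFSet.pair x y ∈ V_ ω := by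
  have key : ∀ {u v : ZFSet.{0}}, u ∈ V_ ω → v ∈ V_ ω → ({u, v} : ZFSet.{0}) ∈ V_ ω := by
    intro u v hu hv
    refine mem_vonNeumann_omega0.2 ⟨(Set.toFinite {u, v}).subset fun z hz => ?_, fun z hz => ?_⟩
    · simpa using hz
    · rcases ZFSet.mem_pair.1 hz with rfl | rfl <;> assumption
  have h := key (key hx hx) (key hx hy)
  rwa [ZFSet.pair_eq_singleton] at h

theorem sigmaSet_mem_vonNeumann_omega0 {a : ZFSet.{0}} {b : ZFSet.{0} → ZFSet.{0}}
    (ha : a ∈ V_ ω) (hb : ∀ x ∈ a, b x ∈ V_ ω) : sigmaSet a b ∈ V_ ω := by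
  rw [mem_vonNeumann_omega0]
  constructor
  · refine ((mem_vonNeumann_omega0.1 ha).1.biUnion (t := fun x => ZFSet.pair x '' (b x))
      fun x hx => ((mem_vonNeumann_omega0.1 (hb x hx)).1.image _)).subset fun z hz => ?_
    obtain ⟨x, hx, y, hy, rfl⟩ := mem_sigmaSet.1 hz
    exact Set.mem_biUnion hx ⟨y, hy, rfl⟩
  · intro z hz
    obtain ⟨x, hx, y, hy, rfl⟩ := mem_sigmaSet.1 hz
    exact pair_mem_vonNeumann_omega0 ((mem_vonNeumann_omega0.1 ha).2 x hx)
      ((mem_vonNeumann_omega0.1 (hb x hx)).2 y hy)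

theorem piSet_mem_vonNeumann_omega0 {a : ZFSet.{0}} {b : ZFSet.{0} → ZFSet.{0}}
    (ha : a ∈ V_ ω) (hb : ∀ x ∈ a, b x ∈ V_ ω) : piSet a b ∈ V_ ω := by
  have hs := sigmaSet_mem_vonNeumann_omega0 ha hb
  have hsub : ∀ f ∈ piSet a b, f ⊆ sigmaSet a b := fun f hf =>
    ZFSet.mem_powerset.1 (ZFSet.mem_sep.1 hf).1
  refine mem_vonNeumann_omega0.2
    ⟨?_, fun f hf => ZFSet.mem_vonNeumann_of_subset (hsub f hf) hs⟩
  refine Set.Finite.of_finite_image (f := fun f : ZFSet.{0} => (f : Set ZFSet.{0}))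
    ((mem_vonNeumann_omega0.1 hs).1.finite_subsets.subset ?_) SetLike.coe_injective.injOn
  rintro _ ⟨f, hf, rfl⟩
  exact hsub f hf

/-- The two-element set that interprets `Ans`. -/
noncomputable def ansSet : ZFSet.{0} := {∅, {∅}}

theorem ansSet_mem_vonNeumann_omega0 : ansSet ∈ V_ ω := by
  have h0 : (∅ : ZFSet.{0}) ∈ V_ ω := mem_vonNeumann_omega0.2 ⟨by simp, by simp⟩
  have h1 : ({∅} : ZFSet.{0}) ∈ V_ ω := mem_vonNeumann_omega0.2 ⟨by simp, by simpa using h0⟩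
  refine mem_vonNeumann_omega0.2
    ⟨(Set.toFinite {∅, {∅}}).subset fun z hz => by simpa [ansSet] using hz, fun z hz => ?_⟩
  rcases ZFSet.mem_pair.1 hz with rfl | rfl <;> assumption

/-! ### Interpretation of raw syntax -/

/-- An environment, extended by a value for a fresh variable `0`. -/
def consEnv (x : ZFSet.{0}) (ρ : ℕ → ZFSet.{0}) : ℕ → ZFSet.{0}
  | 0 => x
  | n + 1 => ρ n

mutual

noncomputable def Ty.interp : Ty → (ℕ → ZFSet.{0}) → ZFSet.{0}
  | .ans, _ => ansSet
  | .pi A B, ρ => piSet (A.interp ρ) fun x => B.interp (consEnv x ρ)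
  | .sigma A B, ρ => sigmaSet (A.interp ρ) fun x => B.interp (consEnv x ρ)
  | .univ, _ => V_ ω
  | .el c, ρ => c.interp ρ

noncomputable def Tm.interp : Tm → (ℕ → ZFSet.{0}) → ZFSet.{0}
  | .var n, ρ => ρ n
  | .yes, _ => ∅
  | .no, _ => {∅}
  | .lam A t, ρ => graphOn (A.interp ρ) fun x => t.interp (consEnv x ρ)
  | .app f a, ρ => graphApp (f.interp ρ) (a.interp ρ)
  | .pair a b, ρ => ZFSet.pair (a.interp ρ) (b.interp ρ)
  | .fst p, ρ => pairFst (p.interp ρ)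
  | .snd p, ρ => pairSnd (p.interp ρ)
  | .ansCode, _ => ansSet
  | .piCode a b, ρ => piSet (a.interp ρ) fun x => b.interp (consEnv x ρ)
  | .sigmaCode a b, ρ => sigmaSet (a.interp ρ) fun x => b.interp (consEnv x ρ)

end

theorem consEnv_comp_liftRen (x : ZFSet.{0}) (ρ : ℕ → ZFSet.{0}) (r : ℕ → ℕ) :
    (fun n => consEnv x ρ (liftRen r n)) = consEnv x fun n => ρ (r n) := by
  funext n
  cases n <;> rfl

mutual

theorem Ty.interp_rename (r : ℕ → ℕ) : ∀ (A : Ty) (ρ : ℕ → ZFSet.{0}),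
    (A.rename r).interp ρ = A.interp fun n => ρ (r n)
  | .ans, _ => rfl
  | .pi A B, ρ => by
    simp only [Ty.rename, Ty.interp, Ty.interp_rename r A, Ty.interp_rename (liftRen r) B,
      consEnv_comp_liftRen]
  | .sigma A B, ρ => by
    simp only [Ty.rename, Ty.interp, Ty.interp_rename r A, Ty.interp_rename (liftRen r) B,
      consEnv_comp_liftRen]
  | .univ, _ => rfl
  | .el c, ρ => by simp only [Ty.rename, Ty.interp, Tm.interp_rename r c]

theorem Tm.interp_rename (r : ℕ → ℕ) : ∀ (t : Tm) (ρ : ℕ → ZFSet.{0}),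
    (t.rename r).interp ρ = t.interp fun n => ρ (r n)
  | .var _, _ => rfl
  | .yes, _ => rfl
  | .no, _ => rfl
  | .lam A t, ρ => by
    simp only [Tm.rename, Tm.interp, Ty.interp_rename r A, Tm.interp_rename (liftRen r) t,
      consEnv_comp_liftRen]
  | .app f a, ρ => by
    simp only [Tm.rename, Tm.interp, Tm.interp_rename r f, Tm.interp_rename r a]
  | .pair a b, ρ => by
    simp only [Tm.rename, Tm.interp, Tm.interp_rename r a, Tm.interp_rename r b]
  | .fst p, ρ => by simp only [Tm.rename, Tm.interp, Tm.interp_rename r p]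
  | .snd p, ρ => by simp only [Tm.rename, Tm.interp, Tm.interp_rename r p]
  | .ansCode, _ => rfl
  | .piCode a b, ρ => by
    simp only [Tm.rename, Tm.interp, Tm.interp_rename r a, Tm.interp_rename (liftRen r) b,
      consEnv_comp_liftRen]
  | .sigmaCode a b, ρ => by
    simp only [Tm.rename, Tm.interp, Tm.interp_rename r a, Tm.interp_rename (liftRen r) b,
      consEnv_comp_liftRen]

end

theorem Ty.interp_weaken (A : Ty) (x : ZFSet.{0}) (ρ : ℕ → ZFSet.{0}) :
    A.weaken.interp (consEnv x ρ) = A.interp ρ :=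
  A.interp_rename Nat.succ _

theorem Tm.interp_weaken (t : Tm) (x : ZFSet.{0}) (ρ : ℕ → ZFSet.{0}) :
    t.weaken.interp (consEnv x ρ) = t.interp ρ :=
  t.interp_rename Nat.succ _

theorem interp_liftSub (x : ZFSet.{0}) (ρ : ℕ → ZFSet.{0}) (s : ℕ → Tm) :
    (fun n => (liftSub s n).interp (consEnv x ρ)) = consEnv x fun n => (s n).interp ρ := by
  funext n
  cases n with
  | zero => rfl
  | succ n => exact (s n).interp_weaken x ρ

mutual

theorem Ty.interp_subst (s : ℕ → Tm) : ∀ (A : Ty) (ρ : ℕ → ZFSet.{0}),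
    (A.subst s).interp ρ = A.interp fun n => (s n).interp ρ
  | .ans, _ => rfl
  | .pi A B, ρ => by
    simp only [Ty.subst, Ty.interp, Ty.interp_subst s A, Ty.interp_subst (liftSub s) B,
      interp_liftSub]
  | .sigma A B, ρ => by
    simp only [Ty.subst, Ty.interp, Ty.interp_subst s A, Ty.interp_subst (liftSub s) B,
      interp_liftSub]
  | .univ, _ => rfl
  | .el c, ρ => by simp only [Ty.subst, Ty.interp, Tm.interp_subst s c]

theorem Tm.interp_subst (s : ℕ → Tm) : ∀ (t : Tm) (ρ : ℕ → ZFSet.{0}),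
    (t.subst s).interp ρ = t.interp fun n => (s n).interp ρ
  | .var _, _ => rfl
  | .yes, _ => rfl
  | .no, _ => rfl
  | .lam A t, ρ => by
    simp only [Tm.subst, Tm.interp, Ty.interp_subst s A, Tm.interp_subst (liftSub s) t,
      interp_liftSub]
  | .app f a, ρ => by
    simp only [Tm.subst, Tm.interp, Tm.interp_subst s f, Tm.interp_subst s a]
  | .pair a b, ρ => by
    simp only [Tm.subst, Tm.interp, Tm.interp_subst s a, Tm.interp_subst s b]
  | .fst p, ρ => by simp only [Tm.subst, Tm.interp, Tm.interp_subst s p]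
  | .snd p, ρ => by simp only [Tm.subst, Tm.interp, Tm.interp_subst s p]
  | .ansCode, _ => rfl
  | .piCode a b, ρ => by
    simp only [Tm.subst, Tm.interp, Tm.interp_subst s a, Tm.interp_subst (liftSub s) b,
      interp_liftSub]
  | .sigmaCode a b, ρ => by
    simp only [Tm.subst, Tm.interp, Tm.interp_subst s a, Tm.interp_subst (liftSub s) b,
      interp_liftSub]

end

theorem interp_single (a : Tm) (ρ : ℕ → ZFSet.{0}) :
    (fun n => (single a n).interp ρ) = consEnv (a.interp ρ) ρ := by
  funext n
  cases n <;> rfl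

theorem Ty.interp_inst (B : Ty) (a : Tm) (ρ : ℕ → ZFSet.{0}) :
    (B.inst a).interp ρ = B.interp (consEnv (a.interp ρ) ρ) := by
  rw [Ty.inst, Ty.interp_subst, interp_single]

theorem Tm.interp_inst (t a : Tm) (ρ : ℕ → ZFSet.{0}) :
    (t.inst a).interp ρ = t.interp (consEnv (a.interp ρ) ρ) := by
  rw [Tm.inst, Tm.interp_subst, interp_single]

/-! ### Soundness -/

/-- The environment `ρ` assigns to each variable of `Γ` an element of its type. -/
def Models (ρ : ℕ → ZFSet.{0}) (Γ : Ctx) : Prop :=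
  ∀ n A, Lookup Γ n A → ρ n ∈ A.interp ρ

theorem Models.cons {ρ : ℕ → ZFSet.{0}} {Γ : Ctx} {A : Ty} {x : ZFSet.{0}} (hρ : Models ρ Γ)
    (hx : x ∈ A.interp ρ) : Models (consEnv x ρ) (A :: Γ) := by
  intro n B h
  cases h with
  | here => rwa [Ty.interp_weaken]
  | there h => rw [Ty.interp_weaken]; exact hρ _ _ h

mutual

theorem TyEq.sound {Γ : Ctx} {A B : Ty} (h : TyEq Γ A B) {ρ : ℕ → ZFSet.{0}} (hρ : Models ρ Γ) :
    A.interp ρ = B.interp ρ :=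
  match h with
  | .refl _ => rfl
  | .symm h => (h.sound hρ).symm
  | .trans h h' => (h.sound hρ).trans (h'.sound hρ)
  | .pi_congr _ hA hB => by
    simp only [Ty.interp]
    rw [← hA.sound hρ]
    exact piSet_congr fun x hx => hB.sound (hρ.cons hx)
  | .sigma_congr _ hA hB => by
    simp only [Ty.interp]
    rw [← hA.sound hρ]
    exact sigmaSet_congr fun x hx => hB.sound (hρ.cons hx)
  | .el_congr h => h.sound hρ
  | .el_ans _ => rfl
  | .el_pi _ _ => rfl
  | .el_sigma _ _ => rfl

theorem HasTy.sound {Γ : Ctx} {t : Tm} {A : Ty} (h : HasTy Γ t A) {ρ : ℕ → ZFSet.{0}}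
    (hρ : Models ρ Γ) : t.interp ρ ∈ A.interp ρ :=
  match h with
  | .var _ hn => hρ _ _ hn
  | .conv h e => e.sound hρ ▸ h.sound hρ
  | .yes _ => ZFSet.mem_pair.2 (Or.inl rfl)
  | .no _ => ZFSet.mem_pair.2 (Or.inr rfl)
  | .lam _ ht => mem_piSet.2 ⟨_, rfl, fun _ hx => ht.sound (hρ.cons hx)⟩
  | .app hf ha => by
    rw [Ty.interp_inst]
    exact graphApp_mem (hf.sound hρ) (ha.sound hρ)
  | .pair _ ha hb => by
    have hb := hb.sound hρ
    rw [Ty.interp_inst] at hb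
    exact pair_mem_sigmaSet.2 ⟨ha.sound hρ, hb⟩
  | .fst hp => by
    obtain ⟨x, hx, y, hy, e⟩ := mem_sigmaSet.1 (hp.sound hρ)
    simp only [Tm.interp]
    rwa [← e, pairFst_pair]
  | .snd hp => by
    obtain ⟨x, hx, y, hy, e⟩ := mem_sigmaSet.1 (hp.sound hρ)
    simp only [Ty.interp_inst, Tm.interp]
    rwa [← e, pairFst_pair, pairSnd_pair]
  | .ansCode _ => ansSet_mem_vonNeumann_omega0
  | .piCode ha hb =>
    piSet_mem_vonNeumann_omega0 (ha.sound hρ) fun _ hx => hb.sound (hρ.cons hx)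
  | .sigmaCode ha hb =>
    sigmaSet_mem_vonNeumann_omega0 (ha.sound hρ) fun _ hx => hb.sound (hρ.cons hx)

theorem TmEq.sound {Γ : Ctx} {t t' : Tm} {A : Ty} (h : TmEq Γ t t' A) {ρ : ℕ → ZFSet.{0}}
    (hρ : Models ρ Γ) : t.interp ρ = t'.interp ρ :=
  match h with
  | .refl _ => rfl
  | .symm h => (h.sound hρ).symm
  | .trans h h' => (h.sound hρ).trans (h'.sound hρ)
  | .conv h _ => h.sound hρ
  | .lam_congr _ hA ht => by
    simp only [Tm.interp]
    rw [← hA.sound hρ]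
    exact graphOn_congr fun x hx => ht.sound (hρ.cons hx)
  | .app_congr hf ha => by simp only [Tm.interp, hf.sound hρ, ha.sound hρ]
  | .pair_congr _ ha hb => by simp only [Tm.interp, ha.sound hρ, hb.sound hρ]
  | .fst_congr hp => by simp only [Tm.interp, hp.sound hρ]
  | .snd_congr hp => by simp only [Tm.interp, hp.sound hρ]
  | .piCode_congr _ ha hb => by
    simp only [Tm.interp]
    rw [← ha.sound hρ]
    exact piSet_congr fun x hx => hb.sound (hρ.cons hx)
  | .sigmaCode_congr _ ha hb => by
    simp only [Tm.interp]
    rw [← ha.sound hρ]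
    exact sigmaSet_congr fun x hx => hb.sound (hρ.cons hx)
  | .pi_beta _ ha => by
    rw [Tm.interp_inst]
    exact graphApp_graphOn _ (ha.sound hρ)
  | .pi_eta hf => by
    simp only [Tm.interp, Tm.interp_weaken]
    exact (graphOn_graphApp (hf.sound hρ)).symm
  | .fst_beta _ _ _ => pairFst_pair _ _
  | .snd_beta _ _ _ => pairSnd_pair _ _
  | .sigma_eta hp => by
    obtain ⟨x, hx, y, hy, e⟩ := mem_sigmaSet.1 (hp.sound hρ)
    simp only [Tm.interp]
    rw [← e, pairFst_pair, pairSnd_pair]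

end

end DepTT

/-- The judgement `⊢ yes = no : Ans` in the empty context is not derivable. -/
theorem mainTheorem9 : ¬ DepTT.TmEq [] DepTT.Tm.yes DepTT.Tm.no DepTT.Ty.ans := by
  intro h
  have e : (∅ : ZFSet.{0}) = {∅} := h.sound (ρ := fun _ => ∅) fun _ _ hn => nomatch hn
  have h0 : (∅ : ZFSet.{0}) ∈ ({∅} : ZFSet.{0}) := ZFSet.mem_singleton.2 rfl
  rw [← e] at h0
  exact ZFSet.notMem_empty ∅ h0
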